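/- **Theorem 1.** Let $X$ be an infinite-dimensional Banach space over $F\in\{\mathbb R,\mathbb C\}$ and let $T:X\to X$ be a linear isometry, i.e. an $F$-linear map with $\|Tx\|=\|x\|$ for all $x$ (surjective or not; in particular, $T$ may be any invertible isometry). Write $\rho(x,K)$ for the distance from a point $x$ to a set $K$ (with $\rho(x,\emptyset)=\infty$). Then: (i) $T$ has no occasionally attracting compact set, that is, there is no compact set $K\subseteq X$ such that $$\liminf_{n\to\infty}\rho(T^nx,K)=0\qquad\text{for every } x\in X \text{ with } \|x\|\le 1.$$ (ii) In the equivalent formulation, $T$ is not compact-supercyclic, that is, there is no compact set $K\subseteq X$ with $0\notin K$ such that the set $$F\cdot O(K)=\{\lambda T^nk : \lambda\in F,\ n\ge 0,\ k\in K\}$$ is dense in $X$. -/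

import Mathlib

open Filter Set

/-- `K` is occasionally attracting for `T`: `liminf ρ(Tⁿ x, K) = 0` for every `x` in the closed
unit ball. The distance is taken in `[0, ∞]`, so that the empty set is at distance `∞` from every
point and is never occasionally attracting. -/
def IsOccasionallyAttracting {X : Type*} [NormedAddCommGroup X] (T : X → X) (K : Set X) : Prop :=
  ∀ x : X, ‖x‖ ≤ 1 → liminf (fun n : ℕ => Metric.infEDist (T^[n] x) K) atTop = 0

/-- The forward orbit `O(K) = ⋃ₙ Tⁿ K` of a set `K`. -/
def setOrbit {X : Type*} (T : X → X) (K : Set X) : Set X :=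
  ⋃ n : ℕ, T^[n] '' K

/-- `T` is compact-supercyclic over the scalar field `𝕜`: there is a compact set `K` with `0 ∉ K`
such that `𝕜 · O(K)` is dense. Without `0 ∉ K` the notion degenerates: in a separable space,
`{0} ∪ {xₙ / n}` with `xₙ` dense in the unit sphere is compact and `𝕜 · K` alone is dense. -/
def IsCompactSupercyclic (𝕜 : Type*) [RCLike 𝕜] {X : Type*} [NormedAddCommGroup X]
    [NormedSpace 𝕜 X] (T : X → X) : Prop :=
  ∃ K : Set X, IsCompact K ∧ (0 : X) ∉ K ∧ Dense {y : X | ∃ c : 𝕜, ∃ z ∈ setOrbit T K, y = c • z}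

/-- An isometry of a nontrivial complex Banach space has an approximate eigenvalue of modulus
one. -/
theorem exists_approx_eigenvalue {Y : Type*} [NormedAddCommGroup Y] [NormedSpace ℂ Y]
    [CompleteSpace Y] [Nontrivial Y] (U : Y →L[ℂ] Y) (hU : ∀ y, ‖U y‖ = ‖y‖) :
    ∃ l : ℂ, ‖l‖ = 1 ∧ ∀ ε > 0, ∃ y, ‖y‖ = 1 ∧ ‖U y - l • y‖ ≤ ε := by
  obtain ⟨l, hl, hlr⟩ := spectrum.exists_nnnorm_eq_spectralRadius U
  have key : ∀ ε > 0, ∃ y, ‖y‖ = 1 ∧ ‖U y - l • y‖ ≤ ε := by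
    by_contra! hcon
    obtain ⟨ε, hε, hcon⟩ := hcon
    have hbelow : ∀ y, ε * ‖y‖ ≤ ‖U y - l • y‖ := by
      intro y
      rcases eq_or_ne y 0 with rfl | hy
      · simp
      have hy' : 0 < ‖y‖ := norm_pos_iff.2 hy
      have h1 := hcon (((‖y‖⁻¹ : ℝ) : ℂ) • y) (by
        rw [norm_smul, Complex.norm_real, norm_inv, norm_norm, inv_mul_cancel₀ hy'.ne'])
      rw [map_smul, smul_comm, ← smul_sub, norm_smul, Complex.norm_real, norm_inv, norm_norm,
        inv_mul_eq_div, lt_div_iff₀ hy'] at h1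
      exact h1.le
    -- a point of the resolvent set close to `l`
    obtain ⟨m, hm, hml⟩ : ∃ m : ℂ, ‖l‖ < ‖m‖ ∧ ‖m - l‖ < ε / 2 := by
      rcases eq_or_ne l 0 with rfl | h0
      · refine ⟨((ε / 4 : ℝ) : ℂ), ?_, ?_⟩ <;>
          simp only [norm_zero, sub_zero, Complex.norm_real, Real.norm_eq_abs,
            abs_of_pos (show 0 < ε / 4 by positivity)] <;> linarith
      · have hl0 : 0 < ‖l‖ := norm_pos_iff.2 h0
        have ht : 0 < ε / (4 * ‖l‖) := by positivity
        refine ⟨((1 + ε / (4 * ‖l‖) : ℝ) : ℂ) * l, ?_, ?_⟩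
        · rw [norm_mul, Complex.norm_real, Real.norm_eq_abs, abs_of_pos (by positivity)]
          nlinarith
        · have : ((1 + ε / (4 * ‖l‖) : ℝ) : ℂ) * l - l = ((ε / (4 * ‖l‖) : ℝ) : ℂ) * l := by
            push_cast; ring
          rw [this, norm_mul, Complex.norm_real, Real.norm_eq_abs, abs_of_pos ht]
          field_simp
          norm_num
    have hres : m ∈ resolventSet ℂ U := by
      apply spectrum.mem_resolventSet_of_spectralRadius_lt
      rw [← hlr]
      exact_mod_cast hm
    obtain ⟨u, hu⟩ := (spectrum.mem_resolventSet_iff.1 hres : IsUnit _)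
    have hlow : ∀ y, ε / 2 * ‖y‖ ≤ ‖(u : Y →L[ℂ] Y) y‖ := by
      intro y
      have h1 : (u : Y →L[ℂ] Y) y = (m - l) • y - (U y - l • y) := by
        rw [hu]
        simp [sub_smul, Algebra.algebraMap_eq_smul_one]
      have h2 := norm_sub_norm_le (U y - l • y) ((m - l) • y)
      rw [norm_sub_rev _ ((m - l) • y), ← h1, norm_smul] at h2
      have := hbelow y
      nlinarith [norm_nonneg y]
    have hinv : ‖((u⁻¹ : (Y →L[ℂ] Y)ˣ) : Y →L[ℂ] Y)‖ ≤ 2 / ε := by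
      refine ContinuousLinearMap.opNorm_le_bound _ (by positivity) fun y => ?_
      have h1 := hlow (((u⁻¹ : (Y →L[ℂ] Y)ˣ) : Y →L[ℂ] Y) y)
      have h2 : (u : Y →L[ℂ] Y) (((u⁻¹ : (Y →L[ℂ] Y)ˣ) : Y →L[ℂ] Y) y) = y := by
        rw [← mul_apply_eq_comp, Units.mul_inv, one_apply_eq_self]
      rw [h2] at h1
      rw [div_mul_eq_mul_div, le_div_iff₀ hε]
      linarith
    have hpos : 0 < ‖((u⁻¹ : (Y →L[ℂ] Y)ˣ) : Y →L[ℂ] Y)‖ := Units.norm_pos _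
    have hnear : ‖(algebraMap ℂ (Y →L[ℂ] Y) l - U) - u‖ <
        ‖((u⁻¹ : (Y →L[ℂ] Y)ˣ) : Y →L[ℂ] Y)‖⁻¹ := by
      have : (algebraMap ℂ (Y →L[ℂ] Y) l - U) - u = algebraMap ℂ (Y →L[ℂ] Y) (l - m) := by
        rw [hu, map_sub]; abel
      rw [this, norm_algebraMap', norm_sub_rev]
      refine hml.trans_le ?_
      rw [le_inv_comm₀ (by positivity) hpos, inv_div]
      exact hinv
    exact hl (Units.ofNearby u _ hnear).isUnit
  refine ⟨l, ?_, key⟩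
  refine eq_of_abs_sub_le_all fun ε hε => ?_
  obtain ⟨y, hy, hle⟩ := key ε hε
  have := (abs_norm_sub_norm_le (l • y) (U y)).trans (norm_sub_rev (l • y) (U y) ▸ hle)
  rwa [norm_smul, hU, hy, mul_one] at this

/-- The complexification of a real normed space `X`, realised as the space of real-linear maps
`ℂ → X` on which `ℂ` acts by precomposition. -/
def Complexified (X : Type*) [NormedAddCommGroup X] [NormedSpace ℝ X] : Type _ := ℂ →L[ℝ] X

namespace Complexified

variable {X : Type*} [NormedAddCommGroup X] [NormedSpace ℝ X]

noncomputable instance : NormedAddCommGroup (Complexified X) :=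
  inferInstanceAs (NormedAddCommGroup (ℂ →L[ℝ] X))

instance [CompleteSpace X] : CompleteSpace (Complexified X) :=
  inferInstanceAs (CompleteSpace (ℂ →L[ℝ] X))

/-- The underlying real-linear map. -/
def toMap (f : Complexified X) : ℂ →L[ℝ] X := f

noncomputable instance : SMul ℂ (Complexified X) :=
  ⟨fun c f => f.toMap.comp (ContinuousLinearMap.mul ℝ ℂ c)⟩

theorem toMap_smul (c : ℂ) (f : Complexified X) (z : ℂ) :
    (c • f).toMap z = f.toMap (c * z) := rfl

theorem toMap_add (f g : Complexified X) (z : ℂ) :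
    (f + g).toMap z = f.toMap z + g.toMap z := rfl

theorem toMap_zero (z : ℂ) : (0 : Complexified X).toMap z = 0 := rfl

theorem ext_toMap {f g : Complexified X} (h : ∀ z, f.toMap z = g.toMap z) : f = g :=
  ContinuousLinearMap.ext h

theorem norm_toMap_le (f : Complexified X) (z : ℂ) : ‖f.toMap z‖ ≤ ‖f‖ * ‖z‖ :=
  f.toMap.le_opNorm z

theorem norm_le_of_forall {f : Complexified X} {C : ℝ} (hC : 0 ≤ C)
    (h : ∀ z, ‖f.toMap z‖ ≤ C * ‖z‖) : ‖f‖ ≤ C :=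
  f.toMap.opNorm_le_bound hC h

noncomputable instance : Module ℂ (Complexified X) where
  one_smul f := ext_toMap fun z => by rw [toMap_smul, one_mul]
  mul_smul a b f := ext_toMap fun z => by
    rw [toMap_smul, toMap_smul, toMap_smul, ← mul_assoc, mul_comm a b]
  smul_zero a := rfl
  smul_add a f g := rfl
  add_smul a b f := ext_toMap fun z => by
    rw [toMap_add, toMap_smul, toMap_smul, toMap_smul, add_mul, map_add]
  zero_smul f := ext_toMap fun z => by rw [toMap_smul, zero_mul, map_zero, toMap_zero]

noncomputable instance : NormedSpace ℂ (Complexified X) where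
  norm_smul_le a f := norm_le_of_forall (by positivity) fun z => by
    rw [toMap_smul]
    refine (norm_toMap_le f _).trans (le_of_eq ?_)
    rw [norm_mul]; ring

instance [Nontrivial X] : Nontrivial (Complexified X) := by
  obtain ⟨x, hx⟩ := exists_ne (0 : X)
  refine ⟨(Complex.reCLM.smulRight x : ℂ →L[ℝ] X), 0, fun h => hx ?_⟩
  have : (Complex.reCLM.smulRight x : ℂ →L[ℝ] X) 1 = (0 : ℂ →L[ℝ] X) 1 :=
    congrArg (fun f : Complexified X => f.toMap 1) h
  simpa using this

/-- The complexification of a real operator. -/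
noncomputable def extend (L : X →L[ℝ] X) : Complexified X →L[ℂ] Complexified X :=
  LinearMap.mkContinuous
    { toFun := fun f => (L.comp f.toMap : ℂ →L[ℝ] X)
      map_add' := fun _ _ => ext_toMap fun _ => map_add L _ _
      map_smul' := fun _ _ => rfl } ‖L‖ fun f => L.opNorm_comp_le f.toMap

theorem extend_apply (L : X →L[ℝ] X) (f : Complexified X) (z : ℂ) :
    (extend L f).toMap z = L (f.toMap z) := rfl

theorem norm_extend (L : X →L[ℝ] X) (hL : ∀ x, ‖L x‖ = ‖x‖) (f : Complexified X) :
    ‖extend L f‖ = ‖f‖ := by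
  apply le_antisymm <;> refine norm_le_of_forall (norm_nonneg _) fun z => ?_
  · rw [extend_apply, hL]; exact norm_toMap_le f z
  · rw [← hL, ← extend_apply]; exact norm_toMap_le _ z

end Complexified

section

variable {X : Type*} [NormedAddCommGroup X] [NormedSpace ℝ X]

/-- The operator `L² - 2cL + 1`. -/
noncomputable def quadOp (c : ℝ) (L : X →L[ℝ] X) : X →L[ℝ] X := L ^ 2 - (2 * c) • L + 1

theorem quadOp_apply (c : ℝ) (L : X →L[ℝ] X) (x : X) :
    quadOp c L x = L (L x) - (2 * c) • L x + x := by
  simp [quadOp, pow_two]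

theorem quadOp_apply_comm (c : ℝ) (L : X →L[ℝ] X) (x : X) :
    quadOp c L (L x) = L (quadOp c L x) := by
  simp [quadOp_apply]

/-- For an isometry `L` of a nontrivial real Banach space some `L² - 2cL + 1`, `|c| ≤ 1`, is not
bounded below. -/
theorem exists_approx_ker_quadOp [CompleteSpace X] [Nontrivial X] (L : X →L[ℝ] X)
    (hL : ∀ x, ‖L x‖ = ‖x‖) :
    ∃ c ∈ Icc (-1 : ℝ) 1, ∀ ε > 0, ∃ x, ‖x‖ = 1 ∧ ‖quadOp c L x‖ ≤ ε := by
  obtain ⟨l, hl, happ⟩ := exists_approx_eigenvalue (Complexified.extend L)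
    (Complexified.norm_extend L hL)
  refine ⟨l.re, abs_le.1 (hl ▸ Complex.abs_re_le_norm l), fun ε hε => ?_⟩
  obtain ⟨f, hf, hfε⟩ := happ (ε / 4) (by positivity)
  obtain ⟨z, hz⟩ : ∃ z, 1 / 2 * ‖z‖ < ‖f.toMap z‖ := by
    by_contra! h
    have := Complexified.norm_le_of_forall (by norm_num) h
    rw [hf] at this
    norm_num at this
  have hd : ∀ z, ‖L (f.toMap z) - f.toMap (l * z)‖ ≤ ε / 4 * ‖z‖ := fun z =>
    (Complexified.norm_toMap_le (Complexified.extend L f - l • f) z).trans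
      (by gcongr)
  have hsum : f.toMap (l * ((starRingEnd ℂ) l * z)) = f.toMap z := by
    rw [← mul_assoc, Complex.mul_conj, Complex.normSq_eq_norm_sq, hl]; simp
  have hadd : f.toMap (l * z) + f.toMap ((starRingEnd ℂ) l * z) = (2 * l.re) • f.toMap z := by
    rw [← map_add, ← add_mul, Complex.add_conj, ← map_smul]; simp
  have hquad : quadOp l.re L (f.toMap z) = L (L (f.toMap z) - f.toMap (l * z)) -
      (L (f.toMap ((starRingEnd ℂ) l * z)) - f.toMap (l * ((starRingEnd ℂ) l * z))) := by
    rw [quadOp_apply, hsum, ← map_smul L, ← hadd, map_add, map_sub]; abel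
  have hbound : ‖quadOp l.re L (f.toMap z)‖ ≤ ε / 2 * ‖z‖ := by
    rw [hquad]
    refine (norm_sub_le _ _).trans ?_
    have h1 := hd z
    have h2 := hd ((starRingEnd ℂ) l * z)
    rw [norm_mul, RCLike.norm_conj, hl, one_mul] at h2
    rw [hL]
    linarith
  have hpos : 0 < ‖f.toMap z‖ := lt_of_le_of_lt (by positivity) hz
  refine ⟨‖f.toMap z‖⁻¹ • f.toMap z, ?_, ?_⟩
  · rw [norm_smul, norm_inv, norm_norm, inv_mul_cancel₀ hpos.ne']
  · rw [map_smul, norm_smul, norm_inv, norm_norm, inv_mul_eq_div, div_le_iff₀ hpos]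
    nlinarith

end

section

variable {X : Type*} [NormedAddCommGroup X] [NormedSpace ℝ X]

theorem cos_succ_mul (θ a : ℝ) :
    Real.cos ((a + 1) * θ) = 2 * Real.cos θ * Real.cos (a * θ) - Real.cos ((a - 1) * θ) := by
  rw [add_mul, sub_mul, one_mul, Real.cos_add, Real.cos_sub]; ring

theorem sum_cos_smul_quad (θ : ℝ) (z : ℕ → X) (M : ℕ) :
    ∑ n ∈ Finset.range M, Real.cos (n * θ) •
      (z (n + 2) - (2 * Real.cos θ) • z (n + 1) + z n) =
    z 0 - Real.cos θ • z 1 - Real.cos (M * θ) • z M + Real.cos ((M - 1) * θ) • z (M + 1) := by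
  induction M with
  | zero => simp
  | succ M ih =>
    rw [Finset.sum_range_succ, ih]
    have h := cos_succ_mul θ M
    push_cast
    rw [h, add_sub_cancel_right]
    module

theorem norm_sum_cos_smul_quad_le (θ C : ℝ) (z : ℕ → X) (hz : ∀ n, ‖z n‖ ≤ C) (M : ℕ) :
    ‖∑ n ∈ Finset.range M, Real.cos (n * θ) •
      (z (n + 2) - (2 * Real.cos θ) • z (n + 1) + z n)‖ ≤ 4 * C := by
  have hc : ∀ a n, ‖Real.cos a • z n‖ ≤ C := fun a n => by
    rw [norm_smul, Real.norm_eq_abs]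
    have := mul_le_mul (Real.abs_cos_le_one a) (hz n) (norm_nonneg _) zero_le_one
    linarith
  rw [sum_cos_smul_quad]
  have h1 := norm_add_le (z 0 - Real.cos θ • z 1 - Real.cos (M * θ) • z M)
    (Real.cos ((M - 1) * θ) • z (M + 1))
  have h2 := norm_sub_le (z 0 - Real.cos θ • z 1) (Real.cos (M * θ) • z M)
  have h3 := norm_sub_le (z 0) (Real.cos θ • z 1)
  linarith [hz 0, hc θ 1, hc (M * θ) M, hc ((M - 1) * θ) (M + 1)]

/-- A solution of `z (n + 2) = 2 cos θ z (n + 1) - z n` is a discrete cosine wave. -/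
theorem add_eq_two_cos_smul (θ : ℝ) (z : ℕ → X)
    (hz : ∀ n, z (n + 2) - (2 * Real.cos θ) • z (n + 1) + z n = 0) (N n : ℕ) (hn : n ≤ N) :
    z (N + n) + z (N - n) = (2 * Real.cos (n * θ)) • z N := by
  induction n using Nat.strong_induction_on with
  | _ n ih =>
    match n with
    | 0 => simp [two_smul]
    | 1 =>
      have h := hz (N - 1)
      rw [show N - 1 + 2 = N + 1 by omega, show N - 1 + 1 = N by omega] at h
      rw [Nat.cast_one, one_mul, ← sub_eq_zero, ← h]
      abel
    | n + 2 =>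
      have h1 := ih (n + 1) (by omega) (by omega)
      have h0 := ih n (by omega) (by omega)
      have hu := hz (N + n)
      have hl := hz (N - (n + 2))
      rw [show N - (n + 2) + 2 = N - n by omega, show N - (n + 2) + 1 = N - (n + 1) by omega] at hl
      have hc := cos_succ_mul θ (n + 1 : ℕ)
      rw [Nat.cast_succ, add_sub_cancel_right] at hc
      rw [show ((n + 2 : ℕ) : ℝ) = (n : ℝ) + 1 + 1 by push_cast; ring, hc]
      have e : z (N + (n + 2)) + z (N - (n + 2)) =
          (2 * Real.cos θ) • (z (N + (n + 1)) + z (N - (n + 1))) - (z (N + n) + z (N - n)) := by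
        have := congrArg₂ (· + ·) hu hl
        simp only [add_zero] at this
        rw [← sub_eq_zero, ← this]
        simp only [← add_assoc]
        module
      rw [e, h1, h0]
      push_cast
      module

theorem exists_sum_two_cos_sq_ge (θ : ℝ) :
    ∃ C : ℝ, ∀ N : ℕ, N - C ≤ ∑ n ∈ Finset.range N, 2 * Real.cos (n * θ) ^ 2 := by
  by_cases hs : Real.sin θ = 0
  · refine ⟨0, fun N => ?_⟩
    have : ∀ n : ℕ, Real.sin (n * θ) = 0 := by
      intro n
      induction n with
      | zero => simp
      | succ n ih => push_cast; rw [add_mul, one_mul, Real.sin_add, ih, hs]; simp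
    have h1 : ∀ n ∈ Finset.range N, (1 : ℝ) ≤ 2 * Real.cos (n * θ) ^ 2 := fun n _ => by
      nlinarith [Real.sin_sq_add_cos_sq (n * θ), this n]
    simpa using Finset.card_nsmul_le_sum _ _ _ h1
  · refine ⟨1 / |Real.sin θ|, fun N => ?_⟩
    have hsum : 2 * Real.sin θ * ∑ n ∈ Finset.range N, Real.cos (2 * (n * θ)) =
        Real.sin ((2 * N - 1) * θ) + Real.sin θ := by
      induction N with
      | zero => simp
      | succ N ih =>
        rw [Finset.sum_range_succ, mul_add, ih]
        push_cast
        rw [show (2 * ((N : ℝ) + 1) - 1) * θ = 2 * (N * θ) + θ by ring,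
          show (2 * (N : ℝ) - 1) * θ = 2 * (N * θ) - θ by ring, Real.sin_add, Real.sin_sub]
        ring
    have habs : |∑ n ∈ Finset.range N, Real.cos (2 * (n * θ))| ≤ 1 / |Real.sin θ| := by
      rw [le_div_iff₀ (abs_pos.2 hs)]
      have h1 := congrArg abs hsum
      rw [abs_mul, abs_mul, abs_two] at h1
      have := abs_add_le (Real.sin ((2 * N - 1) * θ)) (Real.sin θ)
      linarith [Real.abs_sin_le_one θ, Real.abs_sin_le_one ((2 * N - 1) * θ)]
    have h2 : ∑ n ∈ Finset.range N, 2 * Real.cos (n * θ) ^ 2 =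
        N + ∑ n ∈ Finset.range N, Real.cos (2 * (n * θ)) := by
      simp only [Real.cos_two_mul, Finset.sum_sub_distrib]
      simp
    rw [h2]
    linarith [(abs_le.1 habs).1]

theorem norm_pow_apply (L : X →L[ℝ] X) (hL : ∀ x, ‖L x‖ = ‖x‖) (n : ℕ) (x : X) :
    ‖(L ^ n) x‖ = ‖x‖ := by
  induction n with
  | zero => simp
  | succ n ih => rw [pow_succ', mul_apply_eq_comp, hL, ih]

/-- The kernel of `L² - 2cL + 1` is uniformly transversal to its range. -/
theorem norm_le_two_mul_norm_sub_quadOp (L : X →L[ℝ] X) (hL : ∀ x, ‖L x‖ = ‖x‖) {c : ℝ}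
    (hc : c ∈ Icc (-1 : ℝ) 1) {y : X} (hy : quadOp c L y = 0) (x : X) :
    ‖y‖ ≤ 2 * ‖y - quadOp c L x‖ := by
  set θ := Real.arccos c
  have hθ : Real.cos θ = c := Real.cos_arccos hc.1 hc.2
  have hq : ∀ (n : ℕ) (v : X), (L ^ n) (quadOp c L v) =
      (L ^ (n + 2)) v - (2 * Real.cos θ) • (L ^ (n + 1)) v + (L ^ n) v := fun n v => by
    rw [quadOp_apply, map_add, map_sub, map_smul, hθ]
    simp [pow_succ]
  obtain ⟨C, hC⟩ := exists_sum_two_cos_sq_ge θ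
  have main : ∀ N : ℕ, (N - C) * ‖y‖ ≤ 2 * N * ‖y - quadOp c L x‖ + 8 * ‖x‖ := by
    intro N
    let B : X → X := fun v =>
      ∑ n ∈ Finset.range N, Real.cos (n * θ) • ((L ^ (N + n)) v + (L ^ (N - n)) v)
    have hBadd : B y = B (y - quadOp c L x) + B (quadOp c L x) := by
      simp only [B, ← Finset.sum_add_distrib, ← smul_add]
      refine Finset.sum_congr rfl fun n _ => ?_
      simp only [map_sub]
      congr 1
      abel
    have hB1 : ∀ v, ‖B v‖ ≤ 2 * N * ‖v‖ := fun v => by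
      refine (norm_sum_le_of_le (n := fun _ => 2 * ‖v‖) _ fun n _ => ?_).trans (le_of_eq ?_)
      · rw [norm_smul, Real.norm_eq_abs]
        have h1 := norm_add_le ((L ^ (N + n)) v) ((L ^ (N - n)) v)
        rw [norm_pow_apply L hL, norm_pow_apply L hL] at h1
        have := mul_le_mul (Real.abs_cos_le_one (n * θ)) h1 (norm_nonneg _) zero_le_one
        linarith
      · simp; ring
    have hB2 : ‖B (quadOp c L x)‖ ≤ 8 * ‖x‖ := by
      have h1 := norm_sum_cos_smul_quad_le θ ‖x‖ (fun n => (L ^ (N + n)) x)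
        (fun n => (norm_pow_apply L hL _ x).le) N
      have h2 := norm_sum_cos_smul_quad_le θ ‖x‖ (fun n => (L ^ (N + 2 - n)) x)
        (fun n => (norm_pow_apply L hL _ x).le) N
      have h3 : B (quadOp c L x) = (∑ n ∈ Finset.range N, Real.cos (n * θ) •
          ((L ^ (N + (n + 2))) x - (2 * Real.cos θ) • (L ^ (N + (n + 1))) x + (L ^ (N + n)) x)) +
          ∑ n ∈ Finset.range N, Real.cos (n * θ) • ((L ^ (N + 2 - (n + 2))) x -
            (2 * Real.cos θ) • (L ^ (N + 2 - (n + 1))) x + (L ^ (N + 2 - n)) x) := by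
        rw [← Finset.sum_add_distrib]
        refine Finset.sum_congr rfl fun n hn => ?_
        have hn := Finset.mem_range.1 hn
        rw [← smul_add, hq, hq, show N + 2 - (n + 2) = N - n by omega,
          show N + 2 - (n + 1) = N - n + 1 by omega, show N + 2 - n = N - n + 2 by omega]
        simp only [← add_assoc]
        congr 1
        abel
      rw [h3]
      refine (norm_add_le _ _).trans ?_
      linarith
    have hB3 : B y = (∑ n ∈ Finset.range N, 2 * Real.cos (n * θ) ^ 2) • (L ^ N) y := by
      rw [Finset.sum_smul]
      refine Finset.sum_congr rfl fun n hn => ?_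
      rw [add_eq_two_cos_smul θ (fun n => (L ^ n) y) (fun n => by rw [← hq, hy, map_zero]) N n
        (Finset.mem_range.1 hn).le, smul_smul]
      congr 1; ring
    calc (N - C) * ‖y‖ ≤ (∑ n ∈ Finset.range N, 2 * Real.cos (n * θ) ^ 2) * ‖y‖ := by
          gcongr; exact hC N
      _ = ‖B y‖ := by
          rw [hB3, norm_smul, norm_pow_apply L hL, Real.norm_of_nonneg]
          exact Finset.sum_nonneg fun n _ => by positivity
      _ ≤ ‖B (y - quadOp c L x)‖ + ‖B (quadOp c L x)‖ := hBadd ▸ norm_add_le _ _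
      _ ≤ _ := add_le_add (hB1 _) hB2
  by_contra! hlt
  obtain ⟨N, hN⟩ := exists_nat_gt ((8 * ‖x‖ + C * ‖y‖) / (‖y‖ - 2 * ‖y - quadOp c L x‖))
  rw [div_lt_iff₀ (by linarith)] at hN
  linarith [main N]

end

/-- The closure of every orbit starting in the closed unit ball meets `K`. -/
def OrbitClosuresMeet {X : Type*} [NormedAddCommGroup X] (T : X → X) (K : Set X) : Prop :=
  ∀ x : X, ‖x‖ ≤ 1 → ∃ k ∈ K, k ∈ closure (range fun n : ℕ => T^[n] x)

theorem orbitClosuresMeet_of_forall_exists_dist_lt {X : Type*} [NormedAddCommGroup X] {T : X → X}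
    {K : Set X} (hK : IsCompact K)
    (h : ∀ x : X, ‖x‖ ≤ 1 → ∀ ε > 0, ∃ n : ℕ, ∃ k ∈ K, dist (T^[n] x) k < ε) :
    OrbitClosuresMeet T K := by
  intro x hx
  have hne : K.Nonempty := by
    obtain ⟨n, k, hk, -⟩ := h x hx 1 one_pos
    exact ⟨k, hk⟩
  obtain ⟨k, hk, hmin⟩ := hK.exists_isMinOn hne
    (Metric.continuous_infDist_pt (range fun n : ℕ => T^[n] x)).continuousOn
  refine ⟨k, hk, (Metric.mem_closure_iff_infDist_zero (range_nonempty _)).2 ?_⟩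
  refine le_antisymm (le_of_forall_pos_le_add fun ε hε => ?_) Metric.infDist_nonneg
  obtain ⟨n, k', hk', hd⟩ := h x hx ε hε
  rw [zero_add]
  refine (hmin hk').trans ((Metric.infDist_le_dist_of_mem (mem_range_self n)).trans ?_)
  rw [dist_comm]
  exact hd.le

section

variable {X : Type*} [NormedAddCommGroup X] [NormedSpace ℝ X]

theorem OrbitClosuresMeet.exists_mem_ker_quadOp [CompleteSpace X] {L : X →L[ℝ] X}
    (hL : ∀ x, ‖L x‖ = ‖x‖) {K : Set X} (hK : IsCompact K) (h : OrbitClosuresMeet L K)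
    (Y : Submodule ℝ X) (hYc : IsClosed (Y : Set X)) (hYL : ∀ y ∈ Y, L y ∈ Y) (hY : Y ≠ ⊥) :
    ∃ c ∈ Icc (-1 : ℝ) 1, ∃ k ∈ K, k ∈ Y ∧ ‖k‖ = 1 ∧ quadOp c L k = 0 := by
  have : Nontrivial Y := Submodule.nontrivial_iff_ne_bot.2 hY
  have : CompleteSpace Y := hYc.completeSpace_coe
  obtain ⟨c, hc, happ⟩ := exists_approx_ker_quadOp
    ((L.comp Y.subtypeL).codRestrict Y fun y => hYL y y.2) fun y => hL y
  refine ⟨c, hc, ?_⟩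
  have hattr : ∀ ε > 0, ∃ k ∈ K, k ∈ Y ∧ ‖k‖ = 1 ∧ ‖quadOp c L k‖ ≤ ε := by
    intro ε hε
    obtain ⟨y, hy, hyε⟩ := happ ε hε
    obtain ⟨k, hk, hcl⟩ := h y hy.le
    refine ⟨k, hk, ?_⟩
    let S : Set X := {v | v ∈ Y ∧ ‖v‖ = 1 ∧ ‖quadOp c L v‖ ≤ ε}
    have hS : IsClosed S := hYc.inter ((isClosed_eq continuous_norm continuous_const).inter
      (isClosed_le (quadOp c L).continuous.norm continuous_const))
    refine closure_minimal (t := S) ?_ hS hcl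
    rintro _ ⟨n, rfl⟩
    induction n with
    | zero =>
      refine ⟨y.2, hy, ?_⟩
      rw [quadOp_apply] at hyε ⊢
      exact hyε
    | succ n ih =>
      simp only [Function.iterate_succ_apply']
      exact ⟨hYL _ ih.1, (hL _).trans ih.2.1, by rw [quadOp_apply_comm, hL]; exact ih.2.2⟩
  have hcomp : IsCompact (K ∩ {v | v ∈ Y ∧ ‖v‖ = 1}) :=
    hK.inter_right (hYc.inter (isClosed_eq continuous_norm continuous_const))
  have hne : (K ∩ {v | v ∈ Y ∧ ‖v‖ = 1}).Nonempty := by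
    obtain ⟨k, h1, h2, h3, -⟩ := hattr 1 one_pos
    exact ⟨k, h1, h2, h3⟩
  obtain ⟨k, hk, hmin⟩ := hcomp.exists_isMinOn hne (quadOp c L).continuous.norm.continuousOn
  refine ⟨k, hk.1, hk.2.1, hk.2.2, norm_le_zero_iff.1 (le_of_forall_pos_le_add fun ε hε => ?_)⟩
  obtain ⟨k', h1, h2, h3, h4⟩ := hattr ε hε
  rw [zero_add]
  exact (hmin ⟨h1, h2, h3⟩).trans h4

/-- Only finitely many of the operators `L² - 2cL + 1` have a unit vector of a given compact set
in their kernel. -/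
theorem finite_setOf_ker_quadOp {L : X →L[ℝ] X} (hL : ∀ x, ‖L x‖ = ‖x‖) {K : Set X}
    (hK : IsCompact K) :
    {c : ℝ | c ∈ Icc (-1 : ℝ) 1 ∧ ∃ k ∈ K, ‖k‖ = 1 ∧ quadOp c L k = 0}.Finite := by
  by_contra hfin
  have hinf : {c : ℝ | c ∈ Icc (-1 : ℝ) 1 ∧ ∃ k ∈ K, ‖k‖ = 1 ∧ quadOp c L k = 0}.Infinite := hfin
  let c := hinf.natEmbedding
  choose hc k hkK hk1 hk using fun n => (c n).2
  have hsep : ∀ m n, m ≠ n → 1 / 2 ≤ ‖k m - k n‖ := by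
    intro m n hmn
    have hne : (c m : ℝ) ≠ c n := fun h => hmn (c.injective (Subtype.ext h))
    have hrange : quadOp (c m) L ((2 * ((c n : ℝ) - c m))⁻¹ • k n) = L (k n) := by
      have hkn := hk n
      rw [quadOp_apply] at hkn
      rw [map_smul, inv_smul_eq_iff₀ (mul_ne_zero two_ne_zero (sub_ne_zero.2 hne.symm)),
        quadOp_apply, ← sub_eq_zero]
      refine Eq.trans ?_ hkn
      module
    have := norm_le_two_mul_norm_sub_quadOp L hL (hc m) (y := L (k m))
      (by rw [quadOp_apply_comm, hk, map_zero]) ((2 * ((c n : ℝ) - c m))⁻¹ • k n)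
    rw [hrange, ← map_sub, hL, hL, hk1] at this
    linarith
  obtain ⟨a, -, φ, hφ, ha⟩ := hK.tendsto_subseq hkK
  obtain ⟨N, hN⟩ := Metric.cauchySeq_iff.1 ha.cauchySeq (1 / 2) (by norm_num)
  have h1 := hN N le_rfl (N + 1) (Nat.le_succ N)
  rw [dist_eq_norm] at h1
  exact absurd h1 (not_lt.2 (hsep _ _ (hφ.injective.ne (Nat.succ_ne_self N).symm)))

theorem OrbitClosuresMeet.isIntegral [CompleteSpace X] {L : X →L[ℝ] X}
    (hL : ∀ x, ‖L x‖ = ‖x‖) {K : Set X} (hK : IsCompact K) (h : OrbitClosuresMeet L K) :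
    IsIntegral ℝ L := by
  let s := (finite_setOf_ker_quadOp hL hK).toFinset
  let q : ℝ → Polynomial ℝ := fun c =>
    Polynomial.X ^ 2 - Polynomial.C (2 * c) * Polynomial.X + 1
  have hq : ∀ c, Polynomial.aeval L (q c) = quadOp c L := fun c => by
    simp only [q, quadOp, map_add, map_sub, map_mul, map_pow, Polynomial.aeval_X,
      Polynomial.aeval_C, map_one, Algebra.smul_def]
  let P : X →L[ℝ] X := Polynomial.aeval L (∏ c ∈ s, q c)
  have hPL : ∀ x, L (P x) = P (L x) := fun x => by
    have : L * P = P * L := by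
      have := congrArg (Polynomial.aeval L) (mul_comm Polynomial.X (∏ c ∈ s, q c))
      rwa [map_mul, map_mul, Polynomial.aeval_X] at this
    exact congrArg (fun A : X →L[ℝ] X => A x) this
  refine ⟨∏ c ∈ s, q c, Polynomial.monic_prod_of_monic _ _ fun c _ => ?_, ?_⟩
  · simp only [q]; monicity!
  change P = 0
  let Y := (LinearMap.range (P : X →ₗ[ℝ] X)).topologicalClosure
  by_contra hP
  have hY : Y ≠ ⊥ := fun hbot => hP <| ContinuousLinearMap.ext fun x => by
    have : P x ∈ Y := Submodule.le_topologicalClosure _ ⟨x, rfl⟩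
    rw [hbot] at this
    exact this
  have hYL : ∀ y ∈ Y, L y ∈ Y := fun y hy => by
    refine map_mem_closure L.continuous hy ?_
    rintro _ ⟨x, rfl⟩
    exact ⟨L x, (hPL x).symm⟩
  obtain ⟨c, hc, k, hkK, hkY, hk1, hk⟩ :=
    h.exists_mem_ker_quadOp hL hK Y (Submodule.isClosed_topologicalClosure _) hYL hY
  have hcs : c ∈ s := (finite_setOf_ker_quadOp hL hK).mem_toFinset.2 ⟨hc, k, hkK, hk1, hk⟩
  have hbound : ∀ y ∈ Y, ‖k‖ ≤ 2 * ‖k - y‖ := by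
    intro y hy
    refine closure_minimal (t := {y | ‖k‖ ≤ 2 * ‖k - y‖}) ?_
      (isClosed_le continuous_const (by fun_prop)) hy
    rintro _ ⟨x, rfl⟩
    obtain ⟨r, hr⟩ := Finset.dvd_prod_of_mem q hcs
    have : P x = quadOp c L (Polynomial.aeval L r x) := by
      simp only [P, hr, map_mul, hq]; rfl
    exact (norm_le_two_mul_norm_sub_quadOp L hL hc hk _).trans_eq
      (by rw [← this]; rfl)
  have := hbound k hkY
  rw [sub_self, norm_zero, hk1] at this
  norm_num at this

/-- If the closures of all orbits of an isometry of a Banach space starting in the unit ball meet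
a fixed compact set, then the unit ball is compact. -/
theorem OrbitClosuresMeet.isCompact_closedBall [CompleteSpace X] {L : X →L[ℝ] X}
    (hL : ∀ x, ‖L x‖ = ‖x‖) {K : Set X} (hK : IsCompact K) (h : OrbitClosuresMeet L K) :
    IsCompact (Metric.closedBall (0 : X) 1) := by
  let A := Algebra.adjoin ℝ {L}
  have : Module.Finite ℝ A := Algebra.finite_adjoin_simple_of_isIntegral (h.isIntegral hL hK)
  have : ProperSpace A := FiniteDimensional.proper_real A
  have hinj : Function.Injective L := fun x y hxy => by
    rw [← sub_eq_zero, ← norm_eq_zero, ← hL, map_sub, hxy, sub_self, norm_zero]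
  let l : A := ⟨L, Algebra.self_mem_adjoin_singleton ℝ L⟩
  have hcancel : ∀ a b : A, l * a = l * b → a = b := fun a b hab =>
    Subtype.ext <| ContinuousLinearMap.ext fun x =>
      hinj (congrArg (fun B : A => (B : X →L[ℝ] X) x) hab)
  obtain ⟨S, hS⟩ := LinearMap.surjective_of_injective (f := LinearMap.mulLeft ℝ l)
    (fun a b hab => hcancel a b hab) 1
  have hlS : l * S = 1 := hS
  have hSl : S * l = 1 := hcancel _ _ (by rw [← mul_assoc, hlS, one_mul, mul_one])
  have hSnorm : ∀ x, ‖(S : X →L[ℝ] X) x‖ = ‖x‖ := fun x => by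
    rw [← hL]
    exact congrArg (fun B : A => ‖(B : X →L[ℝ] X) x‖) hlS
  let C : Set X := (fun p : A × X => (p.1 : X →L[ℝ] X) p.2) '' (Metric.closedBall (0 : A) 1 ×ˢ K)
  have hC : IsCompact C := ((ProperSpace.isCompact_closedBall (0 : A) 1).prod hK).image
    ((continuous_subtype_val.comp continuous_fst).clm_apply continuous_snd)
  refine hC.of_isClosed_subset Metric.isClosed_closedBall fun x hx => ?_
  obtain ⟨k, hk, hcl⟩ := h x (by simpa using hx)
  rw [← hC.isClosed.closure_eq]
  refine Metric.mem_closure_iff.2 fun ε hε => ?_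
  obtain ⟨_, ⟨n, rfl⟩, hn⟩ := Metric.mem_closure_iff.1 hcl ε hε
  refine ⟨((S ^ n : A) : X →L[ℝ] X) k, ⟨(S ^ n, k), ⟨?_, hk⟩, rfl⟩, ?_⟩
  · rw [mem_closedBall_zero_iff]
    refine ContinuousLinearMap.opNorm_le_bound _ zero_le_one fun y => ?_
    rw [one_mul]
    exact (norm_pow_apply (S : X →L[ℝ] X) hSnorm n y).le
  · have hx' : x = ((S ^ n : A) : X →L[ℝ] X) ((L ^ n) x) :=
      (congrArg (fun B : A => (B : X →L[ℝ] X) x) (pow_mul_pow_eq_one n hSl)).symm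
    nth_rewrite 1 [hx']
    rw [dist_eq_norm, ← map_sub, SubmonoidClass.coe_pow, norm_pow_apply _ hSnorm, norm_sub_rev,
      ← dist_eq_norm, FunLike.coe_pow_eq_iterate]
    exact hn

end

section

variable {𝕜 : Type*} [RCLike 𝕜] {X : Type*} [NormedAddCommGroup X] [NormedSpace 𝕜 X]

theorem OrbitClosuresMeet.finiteDimensional [CompleteSpace X] (T : X →ₗᵢ[𝕜] X) {K : Set X}
    (hK : IsCompact K) (h : OrbitClosuresMeet T K) : FiniteDimensional 𝕜 X := by
  let _ : NormedSpace ℝ X := NormedSpace.restrictScalars ℝ 𝕜 X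
  have : IsScalarTower ℝ 𝕜 X := IsScalarTower.of_algebraMap_smul fun _ _ => rfl
  let L : X →L[ℝ] X := T.toContinuousLinearMap.restrictScalars ℝ
  have hball := OrbitClosuresMeet.isCompact_closedBall (L := L) (fun x => T.norm_map x) hK h
  exact FiniteDimensional.of_isCompact_closedBall 𝕜 one_pos hball

/-- The multiples of the points of `K` by scalars of norm at most `C`. -/
def boundedMultiples (𝕜 : Type*) [RCLike 𝕜] {X : Type*} [NormedAddCommGroup X] [NormedSpace 𝕜 X]
    (C : ℝ) (K : Set X) : Set X :=
  (fun p : 𝕜 × X => p.1 • p.2) '' (Metric.closedBall 0 C ×ˢ K)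

theorem isCompact_boundedMultiples {K : Set X} (hK : IsCompact K) (C : ℝ) :
    IsCompact (boundedMultiples 𝕜 C K) :=
  ((isCompact_closedBall 0 C).prod hK).image continuous_smul

theorem exists_pos_le_norm {K : Set X} (hK : IsCompact K) (h0 : (0 : X) ∉ K) :
    ∃ m > 0, ∀ k ∈ K, m ≤ ‖k‖ := by
  obtain ⟨m, hm, hsub⟩ := Metric.isOpen_iff.1 hK.isClosed.isOpen_compl 0 h0
  exact ⟨m, hm, fun k hk => not_lt.1 fun hlt => hsub (mem_ball_zero_iff.2 hlt) hk⟩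

theorem smul_mem_boundedMultiples {K : Set X} {m R : ℝ} (hm : 0 < m) (hmK : ∀ k ∈ K, m ≤ ‖k‖)
    {c : 𝕜} {k : X} (hk : k ∈ K) (hc : ‖c • k‖ ≤ R) : c • k ∈ boundedMultiples 𝕜 (R / m) K := by
  refine ⟨(c, k), ⟨?_, hk⟩, rfl⟩
  rw [mem_closedBall_zero_iff, le_div_iff₀ hm]
  rw [norm_smul] at hc
  exact (mul_le_mul_of_nonneg_left (hmK k hk) (norm_nonneg c)).trans hc

/-- A compact-supercyclic isometry of an infinite-dimensional Banach space is surjective. -/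
theorem surjective_of_dense_smul_setOrbit [CompleteSpace X] (hX : ¬ FiniteDimensional 𝕜 X)
    (T : X →ₗᵢ[𝕜] X) {K : Set X} (hK : IsCompact K) (h0 : (0 : X) ∉ K)
    (hd : Dense {y : X | ∃ c : 𝕜, ∃ z ∈ setOrbit T K, y = c • z}) : Function.Surjective T := by
  by_contra hsurj
  obtain ⟨x, hx⟩ := not_forall.1 hsurj
  obtain ⟨r, hr, hsub⟩ := Metric.isOpen_iff.1
    (T.isometry.isClosedEmbedding.isClosed_range).isOpen_compl x hx
  obtain ⟨m, hm, hmK⟩ := exists_pos_le_norm (X := X) hK h0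
  have hC := isCompact_boundedMultiples (𝕜 := 𝕜) hK ((‖x‖ + r) / m)
  have hball : Metric.ball x r ⊆ boundedMultiples 𝕜 ((‖x‖ + r) / m) K := by
    refine (hd.open_subset_closure_inter Metric.isOpen_ball).trans
      (closure_minimal ?_ hC.isClosed)
    rintro _ ⟨hy, c, z, hz, rfl⟩
    obtain ⟨n, k, hk, rfl⟩ := mem_iUnion.1 hz
    cases n with
    | zero =>
      refine smul_mem_boundedMultiples hm hmK hk ?_
      have h1 := norm_sub_norm_le (c • T^[0] k) x
      have h2 := mem_ball_iff_norm.1 hy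
      linarith
    | succ n =>
      refine absurd ⟨c • T^[n] k, ?_⟩ (hsub hy)
      rw [map_smul, Function.iterate_succ_apply']
  refine hX (FiniteDimensional.of_isCompact_closedBall 𝕜 (half_pos hr) (c := x)
    (hC.of_isClosed_subset Metric.isClosed_closedBall
      ((Metric.closedBall_subset_ball (half_lt_self hr)).trans hball)))

theorem isometry_iterate {Y : Type*} [PseudoEMetricSpace Y] {f : Y → Y} (hf : Isometry f) (n : ℕ) :
    Isometry f^[n] := by
  induction n with
  | zero => exact isometry_id
  | succ n ih => exact ih.comp hf

theorem not_isCompactSupercyclic [CompleteSpace X] (hX : ¬ FiniteDimensional 𝕜 X)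
    (T : X →ₗᵢ[𝕜] X) : ¬ IsCompactSupercyclic 𝕜 T := by
  rintro ⟨K, hK, h0, hd⟩
  let e := LinearIsometryEquiv.ofSurjective T (surjective_of_dense_smul_setOrbit hX T hK h0 hd)
  obtain ⟨m, hm, hmK⟩ := exists_pos_le_norm (X := X) hK h0
  have hC := isCompact_boundedMultiples (𝕜 := 𝕜) hK (2 / m)
  refine hX (OrbitClosuresMeet.finiteDimensional e.symm.toLinearIsometry hC ?_)
  refine orbitClosuresMeet_of_forall_exists_dist_lt hC fun x hx ε hε => ?_
  obtain ⟨_, hdist, c, z, hz, rfl⟩ := Metric.dense_iff.1 hd x (min ε 1) (by positivity)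
  obtain ⟨n, k, hk, rfl⟩ := mem_iUnion.1 hz
  have hiter : ∀ n : ℕ, c • T^[n] k = T^[n] (c • k) := fun n => by
    induction n with
    | zero => rfl
    | succ n ih => rw [Function.iterate_succ_apply', Function.iterate_succ_apply', ← ih, map_smul]
  have hnorm : ‖T^[n] (c • k)‖ = ‖c • k‖ := by
    simpa using (isometry_iterate T.isometry n).norm_map_of_map_zero
      (Function.iterate_fixed (map_zero T) n) (c • k)
  have hinv : e.symm^[n] (T^[n] (c • k)) = c • k :=
    (Function.LeftInverse.iterate (f := T) (g := e.symm) (fun v => e.symm_apply_apply v) n) _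
  rw [hiter, mem_ball_iff_norm, lt_min_iff] at hdist
  refine ⟨n, c • k, smul_mem_boundedMultiples hm hmK hk ?_, ?_⟩
  · have := norm_sub_norm_le (T^[n] (c • k)) x
    rw [hnorm] at this
    linarith
  · have : dist (e.symm^[n] x) (e.symm^[n] (T^[n] (c • k))) = dist x (T^[n] (c • k)) :=
      (isometry_iterate e.symm.isometry n).dist_eq _ _
    rw [hinv] at this
    refine this.trans_lt ?_
    rw [dist_comm, dist_eq_norm]
    exact hdist.1

theorem IsOccasionallyAttracting.orbitClosuresMeet {T : X → X} {K : Set X} (hK : IsCompact K)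
    (h : IsOccasionallyAttracting T K) : OrbitClosuresMeet T K := by
  refine orbitClosuresMeet_of_forall_exists_dist_lt hK fun x hx ε hε => ?_
  have hfreq := frequently_lt_of_liminf_lt (b := ENNReal.ofReal ε) (h :=
    (h x hx).trans_lt (ENNReal.ofReal_pos.2 hε))
  obtain ⟨n, hn⟩ := hfreq.exists
  obtain ⟨k, hk, hlt⟩ := Metric.infEDist_lt_iff.1 hn
  exact ⟨n, k, hk, by rwa [edist_dist, ENNReal.ofReal_lt_ofReal_iff hε] at hlt⟩

end

theorem theorem1 {𝕜 : Type*} [RCLike 𝕜] {X : Type*} [NormedAddCommGroup X] [NormedSpace 𝕜 X]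
    [CompleteSpace X] (hX : ¬ FiniteDimensional 𝕜 X) (T : X →ₗᵢ[𝕜] X) :
    (¬ ∃ K : Set X, IsCompact K ∧ IsOccasionallyAttracting T K) ∧
      ¬ IsCompactSupercyclic 𝕜 T :=
  ⟨fun ⟨_, hK, h⟩ => hX ((h.orbitClosuresMeet hK).finiteDimensional T hK),
    not_isCompactSupercyclic hX T⟩
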